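/- **Model.** All systems are finite-dimensional. In a two-party quantum protocol $\Pi$, Alice and Bob hold systems $A_{\rm IN}$ and $B_{\rm IN}$ and take turns. In each turn the acting party applies a unitary map to everything it holds (including the message just received) and sends a part $C$ of the resulting system (possibly a trivial one) to the other party; after finitely many turns the acting party applies a last unitary and the protocol ends. A reference system $R$ is never acted on. With $S(\rho)=-\operatorname{tr}\rho\log_2\rho$ and $I(X:Y|Z)=S(XZ)+S(YZ)-S(Z)-S(XYZ)$, define, for $\Pi$ applied to a pure state $|\Psi\rangle_{A_{\rm IN}B_{\rm IN}R}$, $$\mathrm{QLA}(\Pi,\Psi)=\sum_{C\text{ sent by Alice}} I(C:R\,|\,B),\qquad \mathrm{QLB}(\Pi,\Psi)=\sum_{C\text{ sent by Bob}} I(C:R\,|\,A),$$ where each term is evaluated in the global state at the moment when the message $C$ has been sent, and $B$ (respectively $A$) is the system then held by the receiver, without $C$. These are the information leaked from Alice to Bob and from Bob to Alice. Let $f:\{0,1\}^n\times\{0,1\}^n\to\{0,1\}$ and let $|\Phi\rangle_{A_EB_E}$ be a unit vector (pre-shared entanglement, possibly trivial). The protocol $\Pi$ *computes $f$ cleanly*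 if for all $x,y\in\{0,1\}^n$ and $z\in\{0,1\}$ it maps $$|x\rangle_A|\vec 0\rangle_{A_0}|y\rangle_B|\vec 0\rangle_{B_0}|\Phi\rangle_{A_EB_E}|z\rangle_{B_{\rm ans}}\ \longmapsto\ |x\rangle_A|\vec 0\rangle_{A_0'}|y\rangle_B|\vec 0\rangle_{B_0'}|\Phi\rangle_{A_EB_E}|z\oplus f(x,y)\rangle_{B_{\rm ans}},$$ where Alice holds $A,A_0,A_E$ at the beginning and $A,A_0',A_E$ at the end, and Bob holds $B,B_0,B_E,B_{\rm ans}$ at the beginning and $B,B_0',B_E,B_{\rm ans}$ at the end. (Blank ancillas may change hands, so the final ancilla systems $A_0',B_0'$ may differ from $A_0,B_0$; the case $A_0'=A_0$, $B_0'=B_0$ is included.) **Corollary.** Let $\Pi$ be a protocol that computes $f$ cleanly, let $\mu_A,\mu_B$ be probability distributions on $\{0,1\}^n$, and let $$|\Psi_{\rm c\text{-}c}\rangle_{A_{\rm IN}B_{\rm IN}R}=\sum_{x,y}\sqrt{\mu_A(x)\mu_B(y)}\;|x\rangle_A|\vec 0\rangle_{A_0}|y\rangle_B|\vec 0\rangle_{B_0}|-\rangle_{B_{\rm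 ans}}|\Phi\rangle_{A_EB_E}|xy\rangle_R,\qquad |-\rangle=\tfrac{1}{\sqrt2}(|0\rangle-|1\rangle).$$ Then $$\mathrm{QLB}(\Pi,\Psi_{\rm c\text{-}c})=\mathrm{QLA}(\Pi,\Psi_{\rm c\text{-}c}).$$ -/

import Mathlib

open scoped Matrix

noncomputable section

namespace CleanProtocol

/-! ### Density matrices and entropies

Finite-dimensional systems are given by a finite type of basis labels: the system `X` has the Hilbert
space `X → ℂ`, and the joint system of `X` and `Y` is `X × Y`. A system of `k` qubits is
`Fin k → Bool`. -/

/-- The density matrix `|ψ⟩⟨ψ|` of a state vector. -/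
def pureDensity {X : Type} (ψ : X → ℂ) : Matrix X X ℂ :=
  Matrix.vecMulVec ψ (star ψ)

/-- Partial trace over the second factor (the first one is kept). -/
def traceSnd {X Y : Type} [Fintype Y] (ρ : Matrix (X × Y) (X × Y) ℂ) : Matrix X X ℂ :=
  Matrix.of fun i j => ∑ y, ρ (i, y) (j, y)

/-- Partial trace over the first factor (the second one is kept). -/
def traceFst {X Y : Type} [Fintype X] (ρ : Matrix (X × Y) (X × Y) ℂ) : Matrix Y Y ℂ :=
  Matrix.of fun i j => ∑ x, ρ (x, i) (x, j)

/-- Partial trace over the middle one of three factors. -/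
def traceMid {X Y Z : Type} [Fintype Y] (ρ : Matrix (X × Y × Z) (X × Y × Z) ℂ) :
    Matrix (X × Z) (X × Z) ℂ :=
  Matrix.of fun i j => ∑ y, ρ (i.1, y, i.2) (j.1, y, j.2)

/-- The von Neumann entropy `S(ρ) = - tr (ρ log₂ ρ)` (in bits). The logarithm is applied through the
functional calculus, with the usual convention `0 log 0 = 0`. -/
def entropy {X : Type} [Fintype X] [DecidableEq X] (ρ : Matrix X X ℂ) : ℝ :=
  -(ρ * cfc (Real.logb 2) ρ).trace.re

/-- The conditional quantum mutual information
`I(X : Y | Z) = S(XZ) + S(YZ) - S(Z) - S(XYZ)` of a state of the system `XYZ`. -/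
def condMutualInfo {X Y Z : Type} [Fintype X] [DecidableEq X] [Fintype Y] [DecidableEq Y]
    [Fintype Z] [DecidableEq Z] (ρ : Matrix (X × Y × Z) (X × Y × Z) ℂ) : ℝ :=
  entropy (traceMid ρ) + entropy (traceFst ρ) - entropy (traceFst (traceFst ρ)) - entropy ρ

/-! ### Two-party quantum protocols -/

inductive Party : Type
  | alice
  | bob

/-- A matrix that is a unitary map from the space `Y → ℂ` onto the space `X → ℂ`. -/
def IsUnitary {X Y : Type} [Fintype X] [DecidableEq X] [Fintype Y] [DecidableEq Y]
    (U : Matrix X Y ℂ) : Prop :=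
  Uᴴ * U = 1 ∧ U * Uᴴ = 1

/-- A finite-dimensional system, given by its finite set of basis labels. -/
structure System : Type 1 where
  label : Type
  [fintype : Fintype label]
  [decEq : DecidableEq label]

instance : CoeSort System Type := ⟨System.label⟩

instance (X : System) : Fintype X := X.fintype

instance (X : System) : DecidableEq X := X.decEq

/-- The system with basis labels `X`. -/
abbrev sys (X : Type) [Fintype X] [DecidableEq X] : System := ⟨X⟩

/-- What remains to be done in an interactive protocol. `Protocol Aout Bout p A C B`: it is the turn
of party `p`, Alice holds the system `A`, Bob holds the system `B`, and the message `C` that was sent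
last has just arrived at party `p`. In the end Alice holds `Aout` and Bob holds `Bout`.

In a turn, a party applies a unitary map to everything that it holds, message included, and either
sends a part of the resulting system to the other party, who is then to act, or ends the protocol. As
all dimensions are arbitrary, a message may be trivial (the one-point type `Unit`). -/
inductive Protocol (Aout Bout : System) : Party → (A C B : System) → Type 1
  | aliceSend {A C B A' C' : System} (U : Matrix (A' × C') (A × C) ℂ) (hU : IsUnitary U)
      (rest : Protocol Aout Bout Party.bob A' C' B) : Protocol Aout Bout Party.alice A C B
  | bobSend {A C B B' C' : System} (U : Matrix (B' × C') (B × C) ℂ) (hU : IsUnitary U)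
      (rest : Protocol Aout Bout Party.alice A C' B') : Protocol Aout Bout Party.bob A C B
  | aliceEnd {A C : System} (U : Matrix Aout (A × C) ℂ) (hU : IsUnitary U) :
      Protocol Aout Bout Party.alice A C Bout
  | bobEnd {C B : System} (U : Matrix Bout (B × C) ℂ) (hU : IsUnitary U) :
      Protocol Aout Bout Party.bob Aout C B

/-- Alice applies `U` to her system and the message, and sends `C'`. The reference system `R` is not
acted on. -/
def aliceStep {A C B R A' C' : Type} [Fintype A] [Fintype C]
    (U : Matrix (A' × C') (A × C) ℂ) (ψ : A × C × B × R → ℂ) : A' × C' × B × R → ℂ :=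
  fun s => ∑ t : A × C, U (s.1, s.2.1) t * ψ (t.1, t.2, s.2.2)

/-- Bob applies `U` to his system and the message, and sends `C'`. -/
def bobStep {A C B R B' C' : Type} [Fintype B] [Fintype C]
    (U : Matrix (B' × C') (B × C) ℂ) (ψ : A × C × B × R → ℂ) : A × C' × B' × R → ℂ :=
  fun s => ∑ t : B × C, U (s.2.2.1, s.2.1) t * ψ (s.1, t.2, t.1, s.2.2.2)

/-- The final state when the protocol is applied to the state `ψ` of Alice's system, the message,
Bob's system and a reference system `R`. -/
def Protocol.run {Aout Bout : System} {R : Type} : {p : Party} → {A C B : System} →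
    Protocol Aout Bout p A C B → (A × C × B × R → ℂ) → (Aout × Bout × R → ℂ)
  | _, _, _, _, .aliceSend U _ rest, ψ => rest.run (aliceStep U ψ)
  | _, _, _, _, .bobSend U _ rest, ψ => rest.run (bobStep U ψ)
  | _, A, C, _, .aliceEnd U _, ψ => fun s => ∑ t : A × C, U s.1 t * ψ (t.1, t.2, s.2)
  | _, _, C, B, .bobEnd U _, ψ => fun s => ∑ t : B × C, U s.2.1 t * ψ (s.1, t.2, t.1, s.2.2)

/-- For a pure state of `A C B R`: the reduced state of `C R B`, where `A` is traced out. -/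
def reducedCRB {A C B R : Type} [Fintype A] (ψ : A × C × B × R → ℂ) :
    Matrix (C × R × B) (C × R × B) ℂ :=
  traceSnd (pureDensity fun s : (C × R × B) × A => ψ (s.2, s.1.1, s.1.2.2, s.1.2.1))

/-- For a pure state of `A C B R`: the reduced state of `C R A`, where `B` is traced out. -/
def reducedCRA {A C B R : Type} [Fintype B] (ψ : A × C × B × R → ℂ) :
    Matrix (C × R × A) (C × R × A) ℂ :=
  traceSnd (pureDensity fun s : (C × R × A) × B => ψ (s.1.2.2, s.1.1, s.2, s.1.2.1))

/-- The information leaked from Alice to Bob: the sum, over all messages `C` sent by Alice, of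
`I(C : R | B)`, where `B` is what Bob holds while the message is on its way. -/
def Protocol.QLA {Aout Bout : System} {R : Type} [Fintype R] [DecidableEq R] :
    {p : Party} → {A C B : System} → Protocol Aout Bout p A C B → (A × C × B × R → ℂ) → ℝ
  | _, _, _, _, .aliceSend U _ rest, ψ =>
      condMutualInfo (reducedCRB (aliceStep U ψ)) + rest.QLA (aliceStep U ψ)
  | _, _, _, _, .bobSend U _ rest, ψ => rest.QLA (bobStep U ψ)
  | _, _, _, _, .aliceEnd _ _, _ => 0
  | _, _, _, _, .bobEnd _ _, _ => 0

/-- The information leaked from Bob to Alice: the sum, over all messages `C` sent by Bob, of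
`I(C : R | A)`, where `A` is what Alice holds while the message is on its way. -/
def Protocol.QLB {Aout Bout : System} {R : Type} [Fintype R] [DecidableEq R] :
    {p : Party} → {A C B : System} → Protocol Aout Bout p A C B → (A × C × B × R → ℂ) → ℝ
  | _, _, _, _, .aliceSend U _ rest, ψ => rest.QLB (aliceStep U ψ)
  | _, _, _, _, .bobSend U _ rest, ψ =>
      condMutualInfo (reducedCRA (bobStep U ψ)) + rest.QLB (bobStep U ψ)
  | _, _, _, _, .aliceEnd _ _, _ => 0
  | _, _, _, _, .bobEnd _ _, _ => 0

/-! ### Clean computation of a Boolean function -/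

/-- Bit strings of length `n`. -/
abbrev Bits (n : ℕ) : Type := Fin n → Bool

/-- Alice's registers: input, ancilla `A0`, her half `EA` of the shared entanglement. -/
abbrev AliceReg (n : ℕ) (A0 EA : Type) : Type := Bits n × A0 × EA

/-- Bob's registers: input, ancilla `B0`, his half `EB` of the shared entanglement, and the answer
qubit. -/
abbrev BobReg (n : ℕ) (B0 EB : Type) : Type := Bits n × B0 × EB × Bool

/-- The state `|x⟩_A |a₀⟩_{A0} |y⟩_B |b₀⟩_{B0} |Φ⟩_{EA EB} |β⟩_{ans}`, where `a₀`, `b₀` label the blank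
states of the ancillas and `β` is a state vector of the answer qubit. -/
def registerState {n : ℕ} {A0 B0 EA EB : Type} [DecidableEq A0] [DecidableEq B0]
    (a₀ : A0) (b₀ : B0) (Φ : EA × EB → ℂ) (x y : Bits n) (β : Bool → ℂ) :
    AliceReg n A0 EA × BobReg n B0 EB → ℂ :=
  fun s => if s.1.1 = x ∧ s.1.2.1 = a₀ ∧ s.2.1 = y ∧ s.2.2.1 = b₀
    then Φ (s.1.2.2, s.2.2.2.1) * β s.2.2.2.2 else 0

/-- The computational basis state `|z⟩` of a qubit. -/
def ket (z : Bool) : Bool → ℂ := Pi.single z 1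

/-- The state `|-⟩ = (|0⟩ - |1⟩)/√2` of a qubit. -/
def ketMinus : Bool → ℂ :=
  fun z => if z then -(1 / (Real.sqrt 2 : ℂ)) else 1 / (Real.sqrt 2 : ℂ)

/-- The protocol `P` cleanly computes `f`: for all inputs `x`, `y` and every initial value `z` of the
answer qubit, `P` maps the initial state with answer `|z⟩` to the same state with answer
`|z ⊕ f(x, y)⟩`, all ancillas being blank again and the entanglement being restored.

The final ancillas `A0'`, `B0'` may differ from the initial ones `A0`, `B0`, so that ancillas may
change hands. The protocol is run without a reference system (`R = Unit`), and no message is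
present in the beginning. -/
def CleanlyComputes {n : ℕ} {A0 B0 A0' B0' EA EB : Type}
    [Fintype A0] [DecidableEq A0] [Fintype B0] [DecidableEq B0]
    [Fintype A0'] [DecidableEq A0'] [Fintype B0'] [DecidableEq B0']
    [Fintype EA] [DecidableEq EA] [Fintype EB] [DecidableEq EB] {p : Party}
    (P : Protocol (sys (AliceReg n A0' EA)) (sys (BobReg n B0' EB)) p
      (sys (AliceReg n A0 EA)) (sys Unit) (sys (BobReg n B0 EB)))
    (a₀ : A0) (b₀ : B0) (a₀' : A0') (b₀' : B0') (Φ : EA × EB → ℂ)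
    (f : Bits n → Bits n → Bool) : Prop :=
  ∀ (x y : Bits n) (z : Bool),
    P.run (R := Unit) (fun s => registerState a₀ b₀ Φ x y (ket z) (s.1, s.2.2.1)) =
      fun s => registerState a₀' b₀' Φ x y (ket (xor z (f x y))) (s.1, s.2.1)

/-- The classical-classical state
`∑ x y, √(μA x * μB y) |x⟩_A |a₀⟩_{A0} |y⟩_B |b₀⟩_{B0} |-⟩_{ans} |Φ⟩_{EA EB} |x y⟩_R`, whose reference
system `R` holds a copy of both inputs. The trivial factor `Unit` stands for the absence of a message
in the beginning. -/
def classicalClassicalState {n : ℕ} {A0 B0 EA EB : Type} [DecidableEq A0] [DecidableEq B0]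
    (a₀ : A0) (b₀ : B0) (Φ : EA × EB → ℂ) (μA μB : Bits n → ℝ) :
    AliceReg n A0 EA × Unit × BobReg n B0 EB × (Bits n × Bits n) → ℂ :=
  fun s => ∑ x : Bits n, ∑ y : Bits n,
    (Real.sqrt (μA x * μB y) : ℂ) * registerState a₀ b₀ Φ x y ketMinus (s.1, s.2.2.1) *
      (if s.2.2.2 = (x, y) then 1 else 0)

end CleanProtocol

end

noncomputable section

namespace CleanProtocol

open Polynomial Matrix

/-! ### Entropy of the two marginals of a bipartite pure state -/

section Entropy

variable {X Y X' Y' Z : Type} [Fintype X] [DecidableEq X] [Fintype Y] [DecidableEq Y]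
  [Fintype X'] [DecidableEq X'] [Fintype Y'] [DecidableEq Y'] [Fintype Z] [DecidableEq Z]

lemma exists_polynomial_eqOn {s : Set ℝ} (hs : s.Finite) (g : ℝ → ℝ) :
    ∃ q : ℝ[X], Set.EqOn g q.eval s := by
  refine ⟨Lagrange.interpolate hs.toFinset id g, fun x hx => ?_⟩
  exact (Lagrange.eval_interpolate_at_node g Function.injective_id.injOn
    (hs.mem_toFinset.2 hx)).symm

lemma aeval_mul_swap (M : Matrix X Y ℂ) (N : Matrix Y X ℂ) (q : ℝ[X]) :
    aeval (M * N) q * M = M * aeval (N * M) q := by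
  induction q using Polynomial.induction_on' with
  | add p q hp hq => simp [hp, hq, Matrix.add_mul, Matrix.mul_add]
  | monomial k c =>
    rw [aeval_monomial, aeval_monomial, ← Algebra.smul_def, ← Algebra.smul_def,
      Matrix.smul_mul, Matrix.mul_smul]
    congr 1
    induction k with
    | zero => simp
    | succ k ih =>
      rw [pow_succ', pow_succ', Matrix.mul_assoc, ih]
      simp only [Matrix.mul_assoc]

lemma aeval_transpose (ρ : Matrix X X ℂ) (q : ℝ[X]) : aeval ρᵀ q = (aeval ρ q)ᵀ := by
  induction q using Polynomial.induction_on' with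
  | add p q hp hq => simp [hp, hq]
  | monomial k c =>
    rw [aeval_monomial, aeval_monomial, ← Algebra.smul_def, ← Algebra.smul_def,
      Matrix.transpose_smul, Matrix.transpose_pow]

lemma entropy_eq_of_eqOn {ρ : Matrix X X ℂ} (hρ : ρ.IsHermitian) {q : ℝ[X]}
    (hq : Set.EqOn (Real.logb 2) q.eval (spectrum ℝ ρ)) :
    entropy ρ = -(ρ * aeval ρ q).trace.re := by
  rw [entropy, cfc_congr hq, cfc_polynomial q ρ hρ.isSelfAdjoint]

lemma entropy_transpose {ρ : Matrix X X ℂ} (hρ : ρ.IsHermitian) : entropy ρᵀ = entropy ρ := by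
  obtain ⟨q, hq⟩ := exists_polynomial_eqOn
    ((Matrix.finite_real_spectrum (A := ρ)).union (Matrix.finite_real_spectrum (A := ρᵀ))) (Real.logb 2)
  rw [entropy_eq_of_eqOn hρ (hq.mono Set.subset_union_left),
    entropy_eq_of_eqOn hρ.transpose (hq.mono Set.subset_union_right), aeval_transpose,
    ← Matrix.transpose_mul, Matrix.trace_transpose, Matrix.trace_mul_comm]

lemma entropy_mul_conjTranspose (M : Matrix X Y ℂ) : entropy (M * Mᴴ) = entropy (Mᴴ * M) := by
  obtain ⟨q, hq⟩ := exists_polynomial_eqOn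
    ((Matrix.finite_real_spectrum (A := M * Mᴴ)).union
      (Matrix.finite_real_spectrum (A := Mᴴ * M))) (Real.logb 2)
  rw [entropy_eq_of_eqOn (isHermitian_mul_conjTranspose_self M) (hq.mono Set.subset_union_left),
    entropy_eq_of_eqOn (isHermitian_conjTranspose_mul_self M) (hq.mono Set.subset_union_right),
    Matrix.trace_mul_comm, ← Matrix.mul_assoc, aeval_mul_swap, Matrix.mul_assoc,
    Matrix.trace_mul_comm, Matrix.mul_assoc, Matrix.trace_mul_comm]

/-- The entropy of the marginal on `X` of the pure state with amplitudes `φ x y`. -/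
def marginalEntropy (φ : X → Y → ℂ) : ℝ :=
  entropy (Matrix.of φ * (Matrix.of φ)ᴴ)

lemma entropy_eq_marginalEntropy {ρ : Matrix X X ℂ} (φ : X → Y → ℂ)
    (h : ∀ i j, ρ i j = ∑ y, φ i y * star (φ j y)) : entropy ρ = marginalEntropy φ := by
  rw [marginalEntropy]
  congr 1
  ext i j
  rw [h, Matrix.mul_apply]
  rfl

lemma marginalEntropy_swap (φ : X → Y → ℂ) :
    marginalEntropy φ = marginalEntropy fun y x => φ x y := by
  rw [marginalEntropy, entropy_mul_conjTranspose,
    ← entropy_transpose (isHermitian_conjTranspose_mul_self _)]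
  refine entropy_eq_marginalEntropy _ fun i j => ?_
  simp [Matrix.mul_apply, mul_comm]

lemma marginalEntropy_mul_left (V : Matrix X' X ℂ) (hV : Vᴴ * V = 1) (M : Matrix X Y ℂ) :
    marginalEntropy (V * M) = marginalEntropy M := by
  change entropy ((V * M) * (V * M)ᴴ) = entropy (M * Mᴴ)
  rw [entropy_mul_conjTranspose, entropy_mul_conjTranspose, Matrix.conjTranspose_mul,
    Matrix.mul_assoc, ← Matrix.mul_assoc Vᴴ, hV, Matrix.one_mul]

lemma marginalEntropy_embed_left (i : X → X') (hi : Function.Injective i) (u : X → ℂ)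
    (hu : ∀ x, star (u x) * u x = 1) (φ : X → Y → ℂ) (φ' : X' → Y → ℂ)
    (h : ∀ x y, φ' (i x) y = u x * φ x y) (h0 : ∀ x' y, x' ∉ Set.range i → φ' x' y = 0) :
    marginalEntropy φ' = marginalEntropy φ := by
  let V : Matrix X' X ℂ := Matrix.of fun x' x => if x' = i x then u x else 0
  have hV : Vᴴ * V = 1 := by
    ext x₁ x₂
    have : (Vᴴ * V) x₁ x₂ = ∑ x', star (if x' = i x₁ then u x₁ else 0) *
        (if x' = i x₂ then u x₂ else 0) := rfl
    rw [this, Finset.sum_eq_single (i x₁)]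
    · by_cases hx : x₁ = x₂
      · subst hx
        simpa using hu x₁
      · simp [hi.ne hx, Matrix.one_apply_ne hx]
    · intro b _ hb
      simp [hb]
    · simp
  rw [← marginalEntropy_mul_left V hV φ]
  congr 1
  funext x' y
  change _ = ∑ x, (if x' = i x then u x else 0) * φ x y
  by_cases hx : x' ∈ Set.range i
  · obtain ⟨x, rfl⟩ := hx
    rw [h, Finset.sum_eq_single x]
    · simp
    · intro b _ hb
      simp [hi.ne hb.symm]
    · simp
  · rw [h0 _ _ hx, Finset.sum_eq_zero]
    intro x _
    rw [if_neg fun hx' => hx ⟨x, hx'.symm⟩, zero_mul]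

/-- Local isometries that map basis vectors to multiples of basis vectors, on both sides. -/
lemma marginalEntropy_embed (i : X → X') (hi : Function.Injective i) (j : Y → Y')
    (hj : Function.Injective j) (u : X → ℂ) (hu : ∀ x, star (u x) * u x = 1) (v : Y → ℂ)
    (hv : ∀ y, star (v y) * v y = 1) (φ : X → Y → ℂ) (φ' : X' → Y' → ℂ)
    (h : ∀ x y, φ' (i x) (j y) = u x * v y * φ x y)
    (h0 : ∀ x' y', x' ∉ Set.range i ∨ y' ∉ Set.range j → φ' x' y' = 0) :
    marginalEntropy φ' = marginalEntropy φ := by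
  rw [marginalEntropy_embed_left i hi u hu (fun x y' => star (u x) * φ' (i x) y') φ'
      (fun x y => by rw [← mul_assoc, mul_comm (u x), hu, one_mul])
      fun x' y hx => h0 _ _ (Or.inl hx), marginalEntropy_swap, marginalEntropy_swap φ]
  refine marginalEntropy_embed_left j hj v hv _ _ (fun y x => ?_) fun y' x hy => ?_
  · rw [h, mul_assoc, ← mul_assoc, hu, one_mul]
  · rw [h0 _ _ (Or.inr hy), mul_zero]

lemma marginalEntropy_reindex (e : X ≃ X') (e' : Y ≃ Y') (φ : X → Y → ℂ) (φ' : X' → Y' → ℂ)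
    (h : ∀ x y, φ' (e x) (e' y) = φ x y) : marginalEntropy φ' = marginalEntropy φ :=
  marginalEntropy_embed e e.injective e' e'.injective (fun _ => 1) (by simp) (fun _ => 1) (by simp)
    φ φ' (by simpa using h) fun x' y' h' => by simp at h'

lemma sum_mul_star_of_isometry {U : Matrix Y' Y ℂ} (hU : Uᴴ * U = 1) (v w : Y → ℂ) :
    ∑ y', (∑ y, U y' y * v y) * star (∑ y, U y' y * w y) = ∑ y, v y * star (w y) := by
  have h : star (U *ᵥ w) ⬝ᵥ (U *ᵥ v) = star w ⬝ᵥ v := by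
    rw [Matrix.star_mulVec, Matrix.dotProduct_mulVec, Matrix.vecMul_vecMul, hU, Matrix.vecMul_one]
  simpa [dotProduct, Matrix.mulVec, mul_comm] using h

lemma marginalEntropy_isometry_right {U : Matrix Y' Y ℂ} (hU : Uᴴ * U = 1) (φ : X → Y → ℂ) :
    marginalEntropy (fun x y' => ∑ y, U y' y * φ x y) = marginalEntropy φ := by
  rw [← entropy_eq_marginalEntropy (ρ := Matrix.of φ * (Matrix.of φ)ᴴ) (φ := fun x y' => _)]
  · rfl
  · intro i j
    rw [sum_mul_star_of_isometry hU, Matrix.mul_apply]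
    rfl

lemma marginalEntropy_isometry_right_prod {U : Matrix Y' Y ℂ} (hU : Uᴴ * U = 1)
    (φ : X → Y × Z → ℂ) :
    marginalEntropy (fun x (y' : Y' × Z) => ∑ y, U y'.1 y * φ x (y, y'.2)) =
      marginalEntropy φ := by
  rw [← entropy_eq_marginalEntropy (ρ := Matrix.of φ * (Matrix.of φ)ᴴ) (φ := fun x y' => _)]
  · rfl
  · intro i j
    rw [Fintype.sum_prod_type_right]
    simp only [sum_mul_star_of_isometry hU]
    rw [Matrix.mul_apply, Fintype.sum_prod_type_right]
    rfl

attribute [irreducible] marginalEntropy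

end Entropy

/-! ### The information that Bob has about the reference system -/

section Information

variable {A C B R : Type} [Fintype A] [DecidableEq A] [Fintype C] [DecidableEq C]
  [Fintype B] [DecidableEq B] [Fintype R] [DecidableEq R]

/-- `I(R : B) = S(R) + S(B) - S(RB)`: the mutual information of Bob and the reference system while
the message is with Alice. -/
def bobInfo (ψ : A × C × B × R → ℂ) : ℝ :=
  marginalEntropy (fun (r : R) (t : (A × C) × B) => ψ (t.1.1, t.1.2, t.2, r)) +
    marginalEntropy (fun (b : B) (t : (A × C) × R) => ψ (t.1.1, t.1.2, b, t.2)) -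
    marginalEntropy (fun (s : B × R) (t : A × C) => ψ (t.1, t.2, s.1, s.2))

/-- `I(R : BC) = S(R) + S(AR) - S(A)`: the mutual information of Bob and the reference system while
the message is with Bob. -/
def bobMessageInfo (ψ : A × C × B × R → ℂ) : ℝ :=
  marginalEntropy (fun (r : R) (t : (B × C) × A) => ψ (t.2, t.1.2, t.1.1, r)) +
    marginalEntropy (fun (s : A × R) (t : B × C) => ψ (s.1, t.2, t.1, s.2)) -
    marginalEntropy (fun (a : A) (t : (B × C) × R) => ψ (a, t.1.2, t.1.1, t.2))

lemma condMutualInfo_reducedCRB (ψ : A × C × B × R → ℂ) :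
    condMutualInfo (reducedCRB ψ) = bobMessageInfo ψ - bobInfo ψ := by
  have h1 : entropy (traceMid (reducedCRB ψ)) =
      marginalEntropy (fun (s : A × R) (t : B × C) => ψ (s.1, t.2, t.1, s.2)) := by
    rw [entropy_eq_marginalEntropy
      (fun (s : C × B) (t : R × A) => ψ (t.2, s.1, s.2, t.1)), marginalEntropy_swap]
    · exact (marginalEntropy_reindex (Equiv.prodComm _ _) (Equiv.prodComm _ _) _ _
        fun _ _ => rfl)
    · intro i j
      rw [Fintype.sum_prod_type]
      rfl
  have h2 : entropy (traceFst (reducedCRB ψ)) =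
      marginalEntropy (fun (s : B × R) (t : A × C) => ψ (t.1, t.2, s.1, s.2)) := by
    rw [entropy_eq_marginalEntropy
      (fun (s : R × B) (t : C × A) => ψ (t.2, t.1, s.2, s.1))]
    · exact (marginalEntropy_reindex (Equiv.prodComm _ _) (Equiv.prodComm _ _) _ _
        fun _ _ => rfl)
    · intro i j
      rw [Fintype.sum_prod_type]
      rfl
  have h3 : entropy (traceFst (traceFst (reducedCRB ψ))) =
      marginalEntropy (fun (b : B) (t : (A × C) × R) => ψ (t.1.1, t.1.2, b, t.2)) := by
    rw [entropy_eq_marginalEntropy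
      (fun (s : B) (t : R × C × A) => ψ (t.2.2, t.2.1, s, t.1))]
    · exact (marginalEntropy_reindex (Equiv.refl _)
        (⟨fun t => (t.2, t.1.2, t.1.1), fun t => ((t.2.2, t.2.1), t.1), fun _ => rfl,
          fun _ => rfl⟩ : (A × C) × R ≃ R × C × A) _ _
        fun _ _ => rfl)
    · intro i j
      simp only [Fintype.sum_prod_type]
      rfl
  have h4 : entropy (reducedCRB ψ) =
      marginalEntropy (fun (a : A) (t : (B × C) × R) => ψ (a, t.1.2, t.1.1, t.2)) := by
    rw [entropy_eq_marginalEntropy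
      (fun (s : C × R × B) (a : A) => ψ (a, s.1, s.2.2, s.2.1)), marginalEntropy_swap]
    · exact (marginalEntropy_reindex (Equiv.refl _)
        ⟨fun t => (t.1.2, t.2, t.1.1), fun t => ((t.2.2, t.1), t.2.1), fun _ => rfl,
          fun _ => rfl⟩ _ _ fun _ _ => rfl)
    · intro i j
      rfl
  have h5 : marginalEntropy (fun (r : R) (t : (B × C) × A) => ψ (t.2, t.1.2, t.1.1, r)) =
      marginalEntropy (fun (r : R) (t : (A × C) × B) => ψ (t.1.1, t.1.2, t.2, r)) :=
    marginalEntropy_reindex (Equiv.refl _)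
      ⟨fun t => ((t.2, t.1.2), t.1.1), fun t => ((t.2, t.1.2), t.1.1), fun _ => rfl,
        fun _ => rfl⟩ _ _ fun _ _ => rfl
  rw [condMutualInfo, h1, h2, h3, h4, bobMessageInfo, bobInfo, h5]
  ring

/-- Exchange of the roles of Alice and Bob. -/
def swapParties (ψ : A × C × B × R → ℂ) : B × C × A × R → ℂ :=
  fun s => ψ (s.2.2.1, s.2.1, s.1, s.2.2.2)

lemma bobInfo_swapParties (ψ : A × C × B × R → ℂ) :
    bobInfo (swapParties ψ) =
    2 * marginalEntropy (fun (r : R) (t : (B × C) × A) => ψ (t.2, t.1.2, t.1.1, r)) -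
      bobMessageInfo ψ := by
  rw [bobInfo, bobMessageInfo]
  simp only [swapParties]
  ring

lemma bobMessageInfo_swapParties (ψ : A × C × B × R → ℂ) :
    bobMessageInfo (swapParties ψ) =
    2 * marginalEntropy (fun (r : R) (t : (A × C) × B) => ψ (t.1.1, t.1.2, t.2, r)) -
      bobInfo ψ := by
  rw [bobInfo, bobMessageInfo]
  simp only [swapParties]
  ring

lemma condMutualInfo_reducedCRA (ψ : A × C × B × R → ℂ) :
    condMutualInfo (reducedCRA ψ) = bobMessageInfo ψ - bobInfo ψ := by
  have h : marginalEntropy (fun (r : R) (t : (B × C) × A) => ψ (t.2, t.1.2, t.1.1, r)) =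
      marginalEntropy (fun (r : R) (t : (A × C) × B) => ψ (t.1.1, t.1.2, t.2, r)) :=
    marginalEntropy_reindex (Equiv.refl _)
      ⟨fun t => ((t.2, t.1.2), t.1.1), fun t => ((t.2, t.1.2), t.1.1), fun _ => rfl,
        fun _ => rfl⟩ _ _ fun _ _ => rfl
  change condMutualInfo (reducedCRB (swapParties ψ)) = _
  rw [condMutualInfo_reducedCRB, bobInfo_swapParties, bobMessageInfo_swapParties, h]
  ring

variable {A' B' C' : Type} [Fintype A'] [DecidableEq A'] [Fintype B'] [DecidableEq B']
  [Fintype C'] [DecidableEq C']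

lemma bobInfo_aliceStep {U : Matrix (A' × C') (A × C) ℂ} (hU : IsUnitary U)
    (ψ : A × C × B × R → ℂ) : bobInfo (aliceStep U ψ) = bobInfo ψ := by
  unfold bobInfo
  refine congrArg₂ (· - ·) (congrArg₂ (· + ·) ?_ ?_) ?_
  · exact marginalEntropy_isometry_right_prod hU.1 fun r t => ψ (t.1.1, t.1.2, t.2, r)
  · exact marginalEntropy_isometry_right_prod hU.1 fun b t => ψ (t.1.1, t.1.2, b, t.2)
  · exact marginalEntropy_isometry_right hU.1
      fun (s : B × R) (t : A × C) => ψ (t.1, t.2, s.1, s.2)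

lemma bobMessageInfo_bobStep {U : Matrix (B' × C') (B × C) ℂ} (hU : IsUnitary U)
    (ψ : A × C × B × R → ℂ) : bobMessageInfo (bobStep U ψ) = bobMessageInfo ψ := by
  unfold bobMessageInfo
  refine congrArg₂ (· - ·) (congrArg₂ (· + ·) ?_ ?_) ?_
  · exact marginalEntropy_isometry_right_prod hU.1 fun r t => ψ (t.2, t.1.2, t.1.1, r)
  · exact marginalEntropy_isometry_right hU.1
      fun (s : A × R) (t : B × C) => ψ (s.1, t.2, t.1, s.2)
  · exact marginalEntropy_isometry_right_prod hU.1 fun a t => ψ (a, t.1.2, t.1.1, t.2)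

/-- A state of Alice, Bob and the reference system, with a trivial message system added. -/
def withoutMessage (φ : A × B × R → ℂ) : A × Unit × B × R → ℂ :=
  fun s => φ (s.1, s.2.2)

lemma bobMessageInfo_eq_bobInfo (ψ : A × Unit × B × R → ℂ) : bobMessageInfo ψ = bobInfo ψ := by
  unfold bobMessageInfo bobInfo
  refine congrArg₂ (· - ·) (congrArg₂ (· + ·) ?_ ?_) ?_
  · exact marginalEntropy_reindex (Equiv.refl _)
      ⟨fun t => ((t.2, t.1.2), t.1.1), fun t => ((t.2, t.1.2), t.1.1), fun _ => rfl,
        fun _ => rfl⟩ _ _ fun _ _ => rfl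
  · rw [marginalEntropy_swap]
    exact marginalEntropy_reindex (Equiv.prodPUnit _).symm
      ⟨fun t => (t.1.1, t.2), fun t => ((t.1, ()), t.2), fun _ => rfl, fun _ => rfl⟩ _ _
      fun _ _ => rfl
  · rw [marginalEntropy_swap]
    exact marginalEntropy_reindex
      ⟨fun t => ((t.1, ()), t.2), fun t => (t.1.1, t.2), fun _ => rfl, fun _ => rfl⟩
      (Equiv.prodPUnit _) _ _ fun _ _ => rfl

/-- Local isometries of Alice and Bob that embed basis vectors, and phases on the reference system,
do not change Bob's information about the reference system. -/
lemma bobInfo_embed (i : A → A') (hi : Function.Injective i) (j : B → B')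
    (hj : Function.Injective j) (u : R → ℂ) (hu : ∀ r, star (u r) * u r = 1)
    (φ : A × B × R → ℂ) (φ' : A' × B' × R → ℂ)
    (h : ∀ a b r, φ' (i a, j b, r) = u r * φ (a, b, r))
    (h0 : ∀ a b r, a ∉ Set.range i ∨ b ∉ Set.range j → φ' (a, b, r) = 0) :
    bobInfo (withoutMessage φ') = bobInfo (withoutMessage φ) := by
  have hik : Function.Injective (Prod.map i id : A × Unit → A' × Unit) :=
    hi.prodMap Function.injective_id
  unfold bobInfo
  refine congrArg₂ (· - ·) (congrArg₂ (· + ·) ?_ ?_) ?_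
  · refine marginalEntropy_embed id Function.injective_id (Prod.map (Prod.map i id) j)
      (hik.prodMap hj) u hu (fun _ => 1) (by simp) _ _ (fun r t => ?_) ?_
    · rw [mul_one]
      exact h _ _ _
    · rintro r ⟨⟨a, k⟩, b⟩ hr
      exact h0 _ _ _ (by simpa [Set.range_prodMap, imp_iff_not_or] using hr)
  · refine marginalEntropy_embed j hj (Prod.map (Prod.map i id) id)
      (hik.prodMap Function.injective_id) (fun _ => 1) (by simp) (fun t => u t.2)
      (fun t => hu t.2) _ _ (fun b t => ?_) ?_
    · rw [one_mul]
      exact h _ _ _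
    · rintro b ⟨⟨a, k⟩, r⟩ hr
      exact h0 _ _ _ (by simpa [Set.range_prodMap, or_comm] using hr)
  · refine marginalEntropy_embed (Prod.map j id) (hj.prodMap Function.injective_id)
      (Prod.map i id) hik (fun s => u s.2) (fun s => hu s.2) (fun _ => 1) (by simp) _ _
      (fun s t => ?_) ?_
    · rw [mul_one]
      exact h _ _ _
    · rintro ⟨b, r⟩ ⟨a, k⟩ hr
      exact h0 _ _ _ (by simpa [Set.range_prodMap, or_comm] using hr)

lemma IsUnitary.addTrivialMessage {U : Matrix A' B ℂ} (hU : IsUnitary U) :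
    IsUnitary (U.submatrix Prod.fst id : Matrix (A' × Unit) B ℂ) := by
  refine ⟨?_, ?_⟩
  · rw [← hU.1]
    ext s t
    simp [Matrix.mul_apply, Fintype.sum_prod_type]
  · ext s t
    have := congrFun (congrFun hU.2 s.1) t.1
    simpa [Matrix.mul_apply, Matrix.one_apply, Prod.ext_iff] using this

lemma bobInfo_withoutMessage_aliceEnd {U : Matrix A' (A × C) ℂ} (hU : IsUnitary U)
    (ψ : A × C × B × R → ℂ) :
    bobInfo (withoutMessage fun s : A' × B × R => ∑ t : A × C, U s.1 t * ψ (t.1, t.2, s.2)) =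
      bobInfo ψ := by
  exact bobInfo_aliceStep hU.addTrivialMessage ψ

lemma bobInfo_withoutMessage_bobEnd {U : Matrix B' (B × C) ℂ} (hU : IsUnitary U)
    (ψ : A × C × B × R → ℂ) :
    bobInfo (withoutMessage fun s : A × B' × R =>
      ∑ t : B × C, U s.2.1 t * ψ (s.1, t.2, t.1, s.2.2)) = bobMessageInfo ψ := by
  rw [← bobMessageInfo_eq_bobInfo]
  exact bobMessageInfo_bobStep hU.addTrivialMessage ψ

/-- Bob's information about the reference system when party `p` has the message. -/
def infoAt (p : Party) (ψ : A × C × B × R → ℂ) : ℝ :=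
  match p with
  | .alice => bobInfo ψ
  | .bob => bobMessageInfo ψ

end Information

/-! ### Protocols -/

/-- In any protocol, the difference of the two leaked informations is the change of Bob's information
about the reference system. -/
lemma QLA_sub_QLB {Aout Bout : System} {R : Type} [Fintype R] [DecidableEq R] {p : Party}
    {A C B : System} (P : Protocol Aout Bout p A C B) (ψ : A × C × B × R → ℂ) :
    P.QLA ψ - P.QLB ψ = bobInfo (withoutMessage (P.run ψ)) - infoAt p ψ := by
  induction P with
  | aliceSend U hU rest ih =>
    have h := ih (aliceStep U ψ)
    simp only [Protocol.QLA, Protocol.QLB, Protocol.run, infoAt] at h ⊢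
    rw [condMutualInfo_reducedCRB, bobInfo_aliceStep hU]
    linarith
  | bobSend U hU rest ih =>
    have h := ih (bobStep U ψ)
    simp only [Protocol.QLA, Protocol.QLB, Protocol.run, infoAt] at h ⊢
    rw [condMutualInfo_reducedCRA, bobMessageInfo_bobStep hU]
    linarith
  | aliceEnd U hU =>
    have h := bobInfo_withoutMessage_aliceEnd hU ψ
    simp only [Protocol.QLA, Protocol.QLB, Protocol.run, infoAt]
    linarith
  | bobEnd U hU =>
    have h := bobInfo_withoutMessage_bobEnd hU ψ
    simp only [Protocol.QLA, Protocol.QLB, Protocol.run, infoAt]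
    linarith

lemma run_eq_run_slice {Aout Bout : System} {R : Type} {p : Party} {A C B : System}
    (P : Protocol Aout Bout p A C B) (ψ : A × C × B × R → ℂ) (a : Aout) (b : Bout)
    (r : R) : P.run ψ (a, b, r) =
      P.run (R := Unit) (fun s => ψ (s.1, s.2.1, s.2.2.1, r)) (a, b, ()) := by
  induction P with
  | aliceSend U hU rest ih => exact ih _
  | bobSend U hU rest ih => exact ih _
  | aliceEnd U hU => rfl
  | bobEnd U hU => rfl

lemma run_smul {Aout Bout : System} {R : Type} {p : Party} {A C B : System}
    (P : Protocol Aout Bout p A C B) (c : ℂ) (ψ : A × C × B × R → ℂ) :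
    P.run (c • ψ) = c • P.run ψ := by
  induction P with
  | aliceSend U hU rest ih =>
    rw [Protocol.run, Protocol.run, ← ih]
    congr 1
    funext s
    simp [aliceStep, Finset.mul_sum, mul_left_comm]
  | bobSend U hU rest ih =>
    rw [Protocol.run, Protocol.run, ← ih]
    congr 1
    funext s
    simp [bobStep, Finset.mul_sum, mul_left_comm]
  | aliceEnd U hU =>
    funext s
    simp [Protocol.run, Finset.mul_sum, mul_left_comm]
  | bobEnd U hU =>
    funext s
    simp [Protocol.run, Finset.mul_sum, mul_left_comm]

lemma run_sub {Aout Bout : System} {R : Type} {p : Party} {A C B : System}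
    (P : Protocol Aout Bout p A C B) (ψ χ : A × C × B × R → ℂ) :
    P.run (ψ - χ) = P.run ψ - P.run χ := by
  induction P with
  | aliceSend U hU rest ih =>
    rw [Protocol.run, Protocol.run, Protocol.run, ← ih]
    congr 1
    funext s
    simp [aliceStep, mul_sub]
  | bobSend U hU rest ih =>
    rw [Protocol.run, Protocol.run, Protocol.run, ← ih]
    congr 1
    funext s
    simp [bobStep, mul_sub]
  | aliceEnd U hU =>
    funext s
    simp [Protocol.run, mul_sub]
  | bobEnd U hU =>
    funext s
    simp [Protocol.run, mul_sub]

/-! ### Clean protocols -/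

section Clean

variable {n : ℕ} {A0 B0 A0' B0' EA EB : Type}
    [Fintype A0] [DecidableEq A0] [Fintype B0] [DecidableEq B0]
    [Fintype A0'] [DecidableEq A0'] [Fintype B0'] [DecidableEq B0']
    [Fintype EA] [DecidableEq EA] [Fintype EB] [DecidableEq EB]

/-- The phase `(-1)^b`. -/
def phase (b : Bool) : ℂ := if b then -1 else 1

lemma star_phase_mul_phase (b : Bool) : star (phase b) * phase b = 1 := by
  cases b <;> simp [phase]

lemma registerState_ketMinus (a₀ : A0) (b₀ : B0) (Φ : EA × EB → ℂ) (x y : Bits n) (w : Bool) :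
    (1 / (Real.sqrt 2 : ℂ)) • (registerState a₀ b₀ Φ x y (ket (xor false w)) -
        registerState a₀ b₀ Φ x y (ket (xor true w))) =
      phase w • registerState a₀ b₀ Φ x y ketMinus := by
  funext s
  obtain ⟨⟨a, a0, ea⟩, b, b0, eb, z⟩ := s
  by_cases h : a = x ∧ a0 = a₀ ∧ b = y ∧ b0 = b₀
  · cases w <;> cases z <;> simp [registerState, h, ket, ketMinus, phase, mul_comm]
  · simp [registerState, h]

/-- The register state for the superposition of inputs with amplitudes `c`, with a reference system
that holds a copy of the inputs. -/
def superposedState (a₀ : A0) (b₀ : B0) (Φ : EA × EB → ℂ) (β : Bool → ℂ)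
    (c : Bits n × Bits n → ℂ) :
    AliceReg n A0 EA × BobReg n B0 EB × (Bits n × Bits n) → ℂ :=
  fun s => c s.2.2 * registerState a₀ b₀ Φ s.2.2.1 s.2.2.2 β (s.1, s.2.1)

lemma classicalClassicalState_eq (a₀ : A0) (b₀ : B0) (Φ : EA × EB → ℂ) (μA μB : Bits n → ℝ) :
    classicalClassicalState a₀ b₀ Φ μA μB = withoutMessage (superposedState a₀ b₀ Φ ketMinus
      fun r => (Real.sqrt (μA r.1 * μB r.2) : ℂ)) := by
  funext s
  obtain ⟨a, u, b, x, y⟩ := s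
  simp only [classicalClassicalState, withoutMessage, superposedState]
  rw [Finset.sum_eq_single x, Finset.sum_eq_single y]
  · simp
  · intro y' _ h
    simp [h.symm]
  · simp
  · intro x' _ h
    simp [h.symm]
  · simp

lemma CleanlyComputes.run_superposedState {p : Party}
    {P : Protocol (sys (AliceReg n A0' EA)) (sys (BobReg n B0' EB)) p
      (sys (AliceReg n A0 EA)) (sys Unit) (sys (BobReg n B0 EB))}
    {a₀ : A0} {b₀ : B0} {a₀' : A0'} {b₀' : B0'} {Φ : EA × EB → ℂ} {f : Bits n → Bits n → Bool}
    (hP : CleanlyComputes P a₀ b₀ a₀' b₀' Φ f) (c : Bits n × Bits n → ℂ) :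
    P.run (withoutMessage (superposedState a₀ b₀ Φ ketMinus c)) =
      superposedState a₀' b₀' Φ ketMinus fun r => phase (f r.1 r.2) * c r := by
  funext s
  obtain ⟨a, b, x, y⟩ := s
  rw [run_eq_run_slice]
  have h : (fun s : AliceReg n A0 EA × Unit × BobReg n B0 EB × Unit =>
      withoutMessage (superposedState a₀ b₀ Φ ketMinus c) (s.1, s.2.1, s.2.2.1, (x, y))) =
      (c (x, y) * (1 / (Real.sqrt 2 : ℂ))) •
        ((fun s => registerState a₀ b₀ Φ x y (ket false) (s.1, s.2.2.1)) -
          fun s => registerState a₀ b₀ Φ x y (ket true) (s.1, s.2.2.1)) := by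
    funext s
    have := congrFun (registerState_ketMinus a₀ b₀ Φ x y false) (s.1, s.2.2.1)
    simp only [Bool.xor_false, phase, Bool.false_eq_true, if_false, one_smul] at this
    rw [mul_smul]
    simp only [withoutMessage, superposedState, ← this]
    rfl
  have h' := congrFun (registerState_ketMinus a₀' b₀' Φ x y (f x y)) (a, b)
  erw [h, run_smul, run_sub, hP x y false, hP x y true]
  rw [mul_smul]
  refine (congrArg (c (x, y) * ·) h').trans ?_
  simp only [superposedState, Pi.smul_apply, smul_eq_mul]
  ring

/-- Changing the blank ancillas and the phases of the amplitudes does not change Bob's information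
about the reference system. -/
lemma bobInfo_superposedState (a₀ : A0) (b₀ : B0) (Φ : EA × EB → ℂ) (β : Bool → ℂ)
    (c u : Bits n × Bits n → ℂ) (hu : ∀ r, star (u r) * u r = 1) :
    bobInfo (withoutMessage (superposedState a₀ b₀ Φ β fun r => u r * c r)) =
      bobInfo (withoutMessage (superposedState () () Φ β c)) := by
  let i : AliceReg n Unit EA → AliceReg n A0 EA := fun s => (s.1, a₀, s.2.2)
  let j : BobReg n Unit EB → BobReg n B0 EB := fun s => (s.1, b₀, s.2.2)
  have hi : Function.Injective i := by
    rintro ⟨x, _, e⟩ ⟨x', _, e'⟩ h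
    simpa [i] using h
  have hj : Function.Injective j := by
    rintro ⟨x, _, e⟩ ⟨x', _, e'⟩ h
    simpa [j] using h
  have key : ∀ a b r, superposedState a₀ b₀ Φ β (fun r => u r * c r) (i a, j b, r) =
      u r * superposedState () () Φ β c (a, b, r) := by
    intro a b r
    simp [superposedState, registerState, i, j, mul_assoc]
  have key0 : ∀ a b r, a ∉ Set.range i ∨ b ∉ Set.range j →
      superposedState a₀ b₀ Φ β (fun r => u r * c r) (a, b, r) = 0 := by
    rintro ⟨x, a, e⟩ ⟨y, b, e', z⟩ r h
    have : ¬ (a = a₀ ∧ b = b₀) := by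
      rintro ⟨rfl, rfl⟩
      rcases h with h | h
      · exact h ⟨(x, (), e), rfl⟩
      · exact h ⟨(y, (), e', z), rfl⟩
    have h' : ¬ (x = r.1 ∧ a = a₀ ∧ y = r.2 ∧ b = b₀) := fun h => this ⟨h.2.1, h.2.2.2⟩
    simp [superposedState, registerState, h']
  exact bobInfo_embed i hi j hj u hu _ _ key key0

end Clean

end CleanProtocol

end

theorem mainTheorem9 {n : ℕ} (f : CleanProtocol.Bits n → CleanProtocol.Bits n → Bool)
    {A0 B0 A0' B0' EA EB : Type}
    [Fintype A0] [DecidableEq A0] [Fintype B0] [DecidableEq B0]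
    [Fintype A0'] [DecidableEq A0'] [Fintype B0'] [DecidableEq B0']
    [Fintype EA] [DecidableEq EA] [Fintype EB] [DecidableEq EB]
    (a₀ : A0) (b₀ : B0) (a₀' : A0') (b₀' : B0')
    (Φ : EA × EB → ℂ) (hΦ : ∑ e, ‖Φ e‖ ^ 2 = 1)
    {p : CleanProtocol.Party}
    (P : CleanProtocol.Protocol
      (CleanProtocol.sys (CleanProtocol.AliceReg n A0' EA))
      (CleanProtocol.sys (CleanProtocol.BobReg n B0' EB)) p
      (CleanProtocol.sys (CleanProtocol.AliceReg n A0 EA)) (CleanProtocol.sys Unit)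
      (CleanProtocol.sys (CleanProtocol.BobReg n B0 EB)))
    (hP : CleanProtocol.CleanlyComputes P a₀ b₀ a₀' b₀' Φ f)
    (μA μB : CleanProtocol.Bits n → ℝ)
    (hμA : μA ∈ stdSimplex ℝ (CleanProtocol.Bits n))
    (hμB : μB ∈ stdSimplex ℝ (CleanProtocol.Bits n)) :
    P.QLB (CleanProtocol.classicalClassicalState a₀ b₀ Φ μA μB) =
      P.QLA (CleanProtocol.classicalClassicalState a₀ b₀ Φ μA μB) := by

  rw [CleanProtocol.classicalClassicalState_eq]
  set c : CleanProtocol.Bits n × CleanProtocol.Bits n → ℂ :=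
    fun r => (Real.sqrt (μA r.1 * μB r.2) : ℂ)
  have h := CleanProtocol.QLA_sub_QLB P (CleanProtocol.withoutMessage
    (CleanProtocol.superposedState a₀ b₀ Φ CleanProtocol.ketMinus c))
  have hfinal := CleanProtocol.bobInfo_superposedState a₀' b₀' Φ CleanProtocol.ketMinus c
    (fun r => CleanProtocol.phase (f r.1 r.2)) fun _ => CleanProtocol.star_phase_mul_phase _
  have hinit := CleanProtocol.bobInfo_superposedState a₀ b₀ Φ CleanProtocol.ketMinus c
    (fun _ => 1) (by simp)
  simp only [one_mul] at hinit
  have hp : CleanProtocol.infoAt p (CleanProtocol.withoutMessage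
      (CleanProtocol.superposedState a₀ b₀ Φ CleanProtocol.ketMinus c)) =
      CleanProtocol.bobInfo (CleanProtocol.withoutMessage
        (CleanProtocol.superposedState a₀ b₀ Φ CleanProtocol.ketMinus c)) := by
    cases p
    · rfl
    · exact CleanProtocol.bobMessageInfo_eq_bobInfo _
  rw [hP.run_superposedState c] at h
  erw [hfinal, hp, hinit, sub_self] at h
  linarith
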